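/- For a prime $p$ and a group $G$, let $\hat G^p$ denote the pro-$p$ completion of $G$, that is, the inverse limit of the quotients $G/N$ with $N\trianglelefteq G$ of finite $p$-power index, and let $c_G^p\colon G\to\hat G^p$ be the completion map. Let $\mathcal C$ be the class of groups $G$ such that, for every prime $p$ and every integer $n\ge 0$, the homomorphism $H^n_{\mathrm{cont}}(\hat G^p,\mathbb Z/p)\to H^n(G,\mathbb Z/p)$ induced by $c_G^p$ from continuous to discrete cohomology is an isomorphism, where $\mathbb Z/p$ is a trivial (and discrete) module. The pro-$p$ topology on a group is the topology for which the normal subgroups of finite $p$-power index form a basis of neighbourhoods of $1$. A subgroup $H\le G$ is topologically $p$-embedded in $G$ if the subspace topology on $H$ inherited from the pro-$p$ topology on $G$ coincides with the pro-$p$ topology on $H$. **Proposition 1.1.** Let $1\to A\xrightarrow{\iota}G\xrightarrow{\epsilon}Q\to 1$ be a central group extension in which $A$ is finitely generated and $Q$ is in $\mathcal C$, and let $p$ be a prime. Then $$1\to\hat A^p\xrightarrow{\hat\iota^p}\hat G^p\xrightarrow{\hat\epsilon^p}\hat Q^p\to 1$$ is a short exact sequence of pro-$p$ groups; in other words, $\iota(A)$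 is topologically $p$-embedded in $G$. -/

import Mathlib

open CategoryTheory

universe u

noncomputable section

namespace ProP

/-- The normal subgroups of `G` whose index is a (finite) power of `p`. -/
structure IndexNormal (p : ℕ) (G : Type u) [Group G] where
  /-- The underlying subgroup. -/
  carrier : Subgroup G
  normal : carrier.Normal
  index_eq : ∃ k : ℕ, carrier.index = p ^ k

attribute [instance] IndexNormal.normal

/-- The preimage, under a homomorphism, of a normal subgroup of `p`-power index. -/
def IndexNormal.comap {p : ℕ} [hp : Fact p.Prime] {G H : Type u} [Group G] [Group H]
    (f : G →* H) (N : IndexNormal p H) : IndexNormal p G where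
  carrier := N.carrier.comap f
  normal := N.normal.comap f
  index_eq := by
    obtain ⟨k, hk⟩ := N.index_eq
    have h : (N.carrier.comap f).index ∣ p ^ k := by
      rw [Subgroup.index_comap, ← hk]
      exact Subgroup.relIndex_dvd_index_of_normal _ _
    obtain ⟨m, -, hm⟩ := (Nat.dvd_prime_pow hp.out).1 h
    exact ⟨m, hm⟩

/-- The quotient `G ⧸ N`, for `N` normal of `p`-power index, as a discrete group. -/
def FinQuot (p : ℕ) (G : Type u) [Group G] (N : IndexNormal p G) : Type u :=
  G ⧸ N.carrier

instance (p : ℕ) (G : Type u) [Group G] (N : IndexNormal p G) : Group (FinQuot p G N) :=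
  inferInstanceAs (Group (G ⧸ N.carrier))

instance (p : ℕ) (G : Type u) [Group G] (N : IndexNormal p G) :
    TopologicalSpace (FinQuot p G N) := ⊥

instance (p : ℕ) (G : Type u) [Group G] (N : IndexNormal p G) :
    DiscreteTopology (FinQuot p G N) := ⟨rfl⟩

/-- The projection `G → G ⧸ N`. -/
def FinQuot.mk {p : ℕ} {G : Type u} [Group G] (N : IndexNormal p G) : G →* FinQuot p G N :=
  QuotientGroup.mk' N.carrier

/-- The homomorphism `G ⧸ N → H ⧸ M` induced by `f : G → H`, when `f` maps `N` into `M`. -/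
def FinQuot.map {p : ℕ} {G H : Type u} [Group G] [Group H] (f : G →* H)
    (N : IndexNormal p G) (M : IndexNormal p H) (h : N.carrier ≤ M.carrier.comap f) :
    FinQuot p G N →* FinQuot p H M :=
  QuotientGroup.map N.carrier M.carrier f h

/-- The projection `G ⧸ N → G ⧸ M` for `N ≤ M`. -/
def FinQuot.proj {p : ℕ} {G : Type u} [Group G] (N M : IndexNormal p G)
    (h : N.carrier ≤ M.carrier) : FinQuot p G N →* FinQuot p G M :=
  FinQuot.map (MonoidHom.id G) N M h

/-- The pro-`p` topology on an abstract group `G`: the coarsest topology for which all the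
projections of `G` onto its discrete quotients of finite `p`-power order are continuous.
Equivalently, the normal subgroups of `p`-power index are a basis of neighbourhoods of `1`. -/
abbrev topology (p : ℕ) (G : Type u) [Group G] : TopologicalSpace G :=
  ⨅ N : IndexNormal p G, TopologicalSpace.induced (FinQuot.mk N) inferInstance

/-- `H` is topologically `p`-embedded in `G`: the subspace topology on `H` inherited from the
pro-`p` topology on `G` is the full pro-`p` topology on `H`. -/
def TopologicallyEmbedded (p : ℕ) {G : Type u} [Group G] (H : Subgroup G) : Prop :=
  TopologicalSpace.induced (Subtype.val : H → G) (topology p G) = topology p H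

/-- The coherent families in the product of all the quotients of `G` of `p`-power order. -/
def coherent (p : ℕ) (G : Type u) [Group G] : Subgroup (∀ N : IndexNormal p G, FinQuot p G N) where
  carrier := {x | ∀ (N M : IndexNormal p G) (h : N.carrier ≤ M.carrier),
    FinQuot.proj N M h (x N) = x M}
  one_mem' _ _ _ := map_one _
  mul_mem' {x y} hx hy N M h := by
    rw [Pi.mul_apply, Pi.mul_apply, map_mul, hx N M h, hy N M h]
  inv_mem' {x} hx N M h := by
    rw [Pi.inv_apply, Pi.inv_apply, map_inv, hx N M h]

/-- The pro-`p` completion of `G`: the inverse limit of the quotients of `G` of `p`-power order,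
with the subspace topology of the product of these discrete groups. -/
abbrev Completion (p : ℕ) (G : Type u) [Group G] : Type u := coherent p G

/-- The completion map from `G` to its pro-`p` completion. -/
def toCompletion (p : ℕ) (G : Type u) [Group G] : G →* Completion p G where
  toFun g := ⟨fun N => FinQuot.mk N g, fun _ _ _ => rfl⟩
  map_one' := rfl
  map_mul' _ _ := rfl

/-- The continuous homomorphism of pro-`p` completions induced by a homomorphism `f : G → H`.
Its component at `M ⊴ H` is the component at `f⁻¹(M)`, followed by `G ⧸ f⁻¹(M) → H ⧸ M`. -/
def Completion.map (p : ℕ) [Fact p.Prime] {G H : Type u} [Group G] [Group H] (f : G →* H) :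
    Completion p G →ₜ* Completion p H where
  toFun x := ⟨fun M => FinQuot.map f (M.comap f) M le_rfl (x.1 (M.comap f)), by
    intro N M h
    have hx := x.2 (N.comap f) (M.comap f) (Subgroup.comap_mono h)
    change FinQuot.proj N M h (FinQuot.map f (N.comap f) N le_rfl (x.1 (N.comap f))) =
      FinQuot.map f (M.comap f) M le_rfl (x.1 (M.comap f))
    rw [← hx]
    obtain ⟨g, hg⟩ := QuotientGroup.mk_surjective (x.1 (N.comap f))
    rw [← hg]
    rfl⟩
  map_one' := Subtype.ext (funext fun _ => map_one _)
  map_mul' _ _ := Subtype.ext (funext fun _ => map_mul _ _ _)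
  continuous_toFun := by
    refine Continuous.subtype_mk (continuous_pi fun M => ?_) _
    exact continuous_of_discreteTopology.comp
      ((continuous_apply (M.comap f)).comp continuous_subtype_val)

/-- Continuous (that is, locally constant) functions `Γⁿ → k` on a topological group `Γ`, where `k`
is discrete: the continuous inhomogeneous `n`-cochains with coefficients in `k`. -/
def contCochainsX (k Γ : Type u) [CommRing k] [TopologicalSpace Γ] (n : ℕ) :
    Submodule k ((Fin n → Γ) → k) where
  carrier := {f | IsLocallyConstant f}
  zero_mem' := IsLocallyConstant.const 0
  add_mem' hf hg := IsLocallyConstant.add hf hg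
  smul_mem' c _ hf := IsLocallyConstant.comp hf (fun x => c • x)

theorem continuous_contractNth {Γ : Type u} [Group Γ] [TopologicalSpace Γ] [IsTopologicalGroup Γ]
    {n : ℕ} (j : Fin (n + 1)) :
    Continuous fun g : Fin (n + 1) → Γ => Fin.contractNth j (· * ·) g := by
  refine continuous_pi fun i => ?_
  unfold Fin.contractNth
  split_ifs <;> fun_prop

theorem d_mem_contCochainsX (k Γ : Type u) [CommRing k] [Group Γ] [TopologicalSpace Γ]
    [IsTopologicalGroup Γ] (n : ℕ) (f : (Fin n → Γ) → k) (hf : f ∈ contCochainsX k Γ n) :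
    (inhomogeneousCochains.d (Rep.trivial k Γ k) n).hom f ∈ contCochainsX k Γ (n + 1) := by
  have key : (inhomogeneousCochains.d (Rep.trivial k Γ k) n).hom f =
      (fun g : Fin (n + 1) → Γ => f fun i => g i.succ) +
        ∑ j : Fin (n + 1), (-1 : k) ^ ((j : ℕ) + 1) •
          fun g : Fin (n + 1) → Γ => f (Fin.contractNth j (· * ·) g) := by
    funext g
    simp [inhomogeneousCochains.d_hom_apply]
  rw [key]
  replace hf : IsLocallyConstant f := hf
  refine Submodule.add_mem _ ?_ (Submodule.sum_mem _ fun j _ => Submodule.smul_mem _ _ ?_)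
  · exact hf.comp_continuous
      (f := fun (g : Fin (n + 1) → Γ) (i : Fin n) => g i.succ) (by fun_prop)
  · exact hf.comp_continuous (continuous_contractNth j)

/-- The usual differential on continuous cochains with trivial coefficients. -/
def contCochainsD (k Γ : Type u) [CommRing k] [Group Γ] [TopologicalSpace Γ]
    [IsTopologicalGroup Γ] (n : ℕ) :
    ModuleCat.of k (contCochainsX k Γ n) ⟶ ModuleCat.of k (contCochainsX k Γ (n + 1)) :=
  ModuleCat.ofHom ((inhomogeneousCochains.d (Rep.trivial k Γ k) n).hom.restrict
    (d_mem_contCochainsX k Γ n))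

/-- The complex of continuous inhomogeneous cochains of a topological group `Γ` with coefficients
in the trivial, discrete module `k`. -/
def contCochains (k Γ : Type u) [CommRing k] [Group Γ] [TopologicalSpace Γ]
    [IsTopologicalGroup Γ] : CochainComplex (ModuleCat k) ℕ :=
  CochainComplex.of (fun n => ModuleCat.of k (contCochainsX k Γ n)) (contCochainsD k Γ) (by
    intro n
    refine ModuleCat.hom_ext (LinearMap.ext fun f => Subtype.ext ?_)
    exact congr($(groupCohomology.inhomogeneousCochains.d_comp_d (A := Rep.trivial k Γ k) n).hom
      f.1))

theorem contCochains.d_def (k Γ : Type u) [CommRing k] [Group Γ] [TopologicalSpace Γ]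
    [IsTopologicalGroup Γ] (n : ℕ) : (contCochains k Γ).d n (n + 1) = contCochainsD k Γ n := by
  simp [contCochains]

/-- The continuous cohomology `Hⁿ_cont(Γ, k)`, for the trivial, discrete module `k`. -/
def contCohomology (k Γ : Type u) [CommRing k] [Group Γ] [TopologicalSpace Γ]
    [IsTopologicalGroup Γ] (n : ℕ) : ModuleCat k :=
  (contCochains k Γ).homology n

/-- Pulling back continuous cochains on `Γ` along a homomorphism `φ : G → Γ` from an abstract
group: `f ↦ ((g₁, …, gₙ) ↦ f (φ g₁, …, φ gₙ))`. -/
def pullback (k : Type u) {G Γ : Type u} [CommRing k] [Group G] [Group Γ] [TopologicalSpace Γ]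
    [IsTopologicalGroup Γ] (φ : G →* Γ) :
    contCochains k Γ ⟶ groupCohomology.inhomogeneousCochains (Rep.trivial k G k) where
  f n := ModuleCat.ofHom
    ((LinearMap.funLeft k k (fun g : Fin n → G => φ ∘ g)).comp (contCochainsX k Γ n).subtype)
  comm' := by
    rintro n _ rfl
    rw [groupCohomology.inhomogeneousCochains.d_def, contCochains.d_def]
    refine ModuleCat.hom_ext (LinearMap.ext fun f => funext fun g => ?_)
    have h (j : Fin (n + 1)) : (φ ∘ Fin.contractNth j (· * ·) g : Fin n → Γ) =
        Fin.contractNth j (· * ·) (φ ∘ g) := by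
      funext i
      simp only [Function.comp_apply, Fin.contractNth]
      split_ifs <;> simp
    change (inhomogeneousCochains.d (Rep.trivial k G k) n).hom (fun g => f.1 (φ ∘ g)) g =
      (inhomogeneousCochains.d (Rep.trivial k Γ k) n).hom f.1 (φ ∘ g)
    simp only [inhomogeneousCochains.d_hom_apply, h]
    rfl

/-- The homomorphism `Hⁿ_cont(Γ, k) → Hⁿ(G, k)` induced by `φ : G → Γ`. -/
def pullbackCohomology (k : Type u) {G Γ : Type u} [CommRing k] [Group G] [Group Γ]
    [TopologicalSpace Γ] [IsTopologicalGroup Γ] (φ : G →* Γ) (n : ℕ) :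
    contCohomology k Γ n ⟶ groupCohomology (Rep.trivial k G k) n :=
  HomologicalComplex.homologyMap (pullback k φ) n

/-- The class `𝒞` of groups `G` such that, for every prime `p` and every `n ≥ 0`, the completion
map induces an isomorphism `Hⁿ_cont(Ĝᵖ, ℤ/p) → Hⁿ(G, ℤ/p)`, with trivial, discrete `ℤ/p`.
(The universe lift of `ℤ/p` has no mathematical content.) -/
def ClassC (G : Type u) [Group G] : Prop :=
  ∀ (p : ℕ) [Fact p.Prime] (n : ℕ),
    IsIso (pullbackCohomology (ULift.{u} (ZMod p)) (toCompletion p G) n)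

end ProP

end

/-!
Everything reduces to one statement about finite quotients: every normal subgroup `N` of `p`-power
index of `A` contains the trace on `A` of a normal subgroup of `p`-power index of `G`
(`ProP.exists_indexNormal_comap_inl_le`). Granting this, `ι(A)` is topologically `p`-embedded and
the map of completions of `A` and `G` is injective. The rest of the exactness holds for any
extension: completions are compact, so images of maps between them are closed, and whether an
element lies in a closed set can be tested in the finite quotients.

To find a subgroup of `G` for a given `N`, push the central extension out along `A → P = A ⧸ N`.
Suppose that its class in `H²(Q, P)` is inflated from a quotient of `Q` of `p`-power order. Then
there is an `A`-equivariant map `ρ : G → P` whose deviation from being a homomorphism only depends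
on the images in that quotient `Q ⧸ N'`, and the elements `g` over `N'` with `ρ g = ρ 1` form the
required subgroup (`ProP.exists_indexNormal_of_map`).

That classes with coefficients in a finite abelian `p`-group `P` are inflated from finite quotients
is where the class `𝒞` enters (`ProP.ClassC.exists_finiteLevel_sub_of_card`). A continuous cochain
on the pro-`p` completion is inflated from a finite quotient by compactness, so surjectivity of the
comparison map in degree `2` is the case `P = ℤ/p`. For `ℤ/p ↪ P ↠ P'`, solve the problem in `P'`
and lift the solution to `P` set-theoretically. The lift `e` need not be a cocycle; its coboundary
is a `ℤ/p`-valued 3-cocycle of finite level that is a coboundary on `Q`, and injectivity of the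
comparison map in degree `3` makes it the coboundary of a cochain of finite level, by which `e` is
corrected. What remains is a `ℤ/p`-valued 2-cocycle. The argument works in every positive degree,
and it is carried out on inhomogeneous cochains.
-/

namespace ProP

/-! ### Homology of complexes of modules, on elements -/

section Homology

variable {k : Type u} [CommRing k] {K L : CochainComplex (ModuleCat.{u} k) ℕ}

theorem exists_cycle {n : ℕ} (x : K.X n) (hx : K.d n (n + 1) x = 0) :
    ∃ z : K.cycles n, K.iCycles n z = x :=
  (ShortComplex.moduleCat_exact_iff _).1
    (ShortComplex.exact_of_f_is_kernel (ShortComplex.mk (K.iCycles n) (K.d n (n + 1)) (by simp))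
      (K.cyclesIsKernel n (n + 1) (by simp))) x hx

theorem homologyπ_eq_zero {n : ℕ} (z : K.cycles (n + 1)) (hz : K.homologyπ (n + 1) z = 0) :
    ∃ w : K.X n, K.d n (n + 1) w = K.iCycles (n + 1) z := by
  obtain ⟨w, hw⟩ := (ShortComplex.moduleCat_exact_iff _).1
    (ShortComplex.exact_of_g_is_cokernel
      (ShortComplex.mk (K.toCycles n (n + 1)) (K.homologyπ (n + 1)) (by simp))
      (K.homologyIsCokernel n (n + 1) (by simp))) z hz
  refine ⟨w, ?_⟩
  rw [← hw, ← K.toCycles_i n (n + 1)]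
  rfl

theorem d_iCycles_apply {n : ℕ} (z : K.cycles n) : K.d n (n + 1) (K.iCycles n z) = 0 := by
  rw [← ModuleCat.comp_apply, HomologicalComplex.iCycles_d]
  rfl

theorem homologyπ_naturality_apply (φ : K ⟶ L) {n : ℕ} (z : K.cycles n) :
    HomologicalComplex.homologyMap φ n (K.homologyπ n z) =
      L.homologyπ n (HomologicalComplex.cyclesMap φ n z) := by
  rw [← ModuleCat.comp_apply, ← ModuleCat.comp_apply,
    HomologicalComplex.homologyπ_naturality]

theorem iCycles_cyclesMap_apply (φ : K ⟶ L) {n : ℕ} (z : K.cycles n) :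
    L.iCycles n (HomologicalComplex.cyclesMap φ n z) = φ.f n (K.iCycles n z) := by
  rw [← ModuleCat.comp_apply, ← ModuleCat.comp_apply, HomologicalComplex.cyclesMap_i]

/-- If `φ` is epi on homology in degree `n + 1`, then each cocycle of the target is, up to a
coboundary, the image of a cocycle of the source. -/
theorem exists_cocycle_of_epi (φ : K ⟶ L) (n : ℕ)
    [Epi (HomologicalComplex.homologyMap φ (n + 1))]
    (y : L.X (n + 1)) (hy : L.d (n + 1) (n + 2) y = 0) :
    ∃ (x : K.X (n + 1)) (w : L.X n),
      K.d (n + 1) (n + 2) x = 0 ∧ y = φ.f (n + 1) x + L.d n (n + 1) w := by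
  obtain ⟨z, rfl⟩ := exists_cycle y hy
  obtain ⟨c, hc⟩ := (ModuleCat.epi_iff_surjective _).1 ‹_› (L.homologyπ (n + 1) z)
  obtain ⟨z', rfl⟩ := (ModuleCat.epi_iff_surjective (K.homologyπ (n + 1))).1 inferInstance c
  rw [homologyπ_naturality_apply] at hc
  obtain ⟨w, hw⟩ := homologyπ_eq_zero (z - HomologicalComplex.cyclesMap φ (n + 1) z')
    (by rw [map_sub, hc, sub_self])
  refine ⟨K.iCycles (n + 1) z', w, d_iCycles_apply z', ?_⟩
  rw [hw, map_sub, iCycles_cyclesMap_apply, add_sub_cancel]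

/-- If `φ` is mono on homology in degree `n + 1`, then a cocycle of the source which becomes a
coboundary in the target is a coboundary. -/
theorem exists_primitive_of_mono (φ : K ⟶ L) (n : ℕ)
    [Mono (HomologicalComplex.homologyMap φ (n + 1))]
    (x : K.X (n + 1)) (hx : K.d (n + 1) (n + 2) x = 0) (w : L.X n)
    (hw : φ.f (n + 1) x = L.d n (n + 1) w) :
    ∃ v : K.X n, K.d n (n + 1) v = x := by
  obtain ⟨z, rfl⟩ := exists_cycle x hx
  refine homologyπ_eq_zero z ((ModuleCat.mono_iff_injective _).1 ‹_› ?_)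
  have h : HomologicalComplex.cyclesMap φ (n + 1) z = L.toCycles n (n + 1) w := by
    refine (ModuleCat.mono_iff_injective (L.iCycles (n + 1))).1 inferInstance ?_
    rw [iCycles_cyclesMap_apply, hw, ← ModuleCat.comp_apply, L.toCycles_i]
  rw [homologyπ_naturality_apply, h, map_zero, ← ModuleCat.comp_apply,
    L.toCycles_comp_homologyπ]
  rfl

end Homology

/-! ### Inhomogeneous cochains with trivial action -/

section Coboundary

variable {G H D : Type*} [Group G] [Group H] {P R : Type*} [AddCommGroup P] [AddCommGroup R]

/-- The differential of inhomogeneous cochains on `G` with values in an abelian group `P` on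
which `G` acts trivially. -/
def coboundary {n : ℕ} (f : (Fin n → G) → P) (g : Fin (n + 1) → G) : P :=
  f (fun i => g i.succ) +
    ∑ j : Fin (n + 1), (-1 : ℤ) ^ ((j : ℕ) + 1) • f (Fin.contractNth j (· * ·) g)

theorem comp_contractNth (φ : G →* H) {n : ℕ} (j : Fin (n + 1)) (g : Fin (n + 1) → G) :
    φ ∘ Fin.contractNth j (· * ·) g = Fin.contractNth j (· * ·) (φ ∘ g) := by
  funext i
  simp only [Function.comp_apply, Fin.contractNth]
  split_ifs <;> simp

theorem coboundary_comp_hom (φ : G →* H) {n : ℕ} (f : (Fin n → H) → P) :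
    coboundary (fun g : Fin n → G => f (φ ∘ g)) = fun g => coboundary f (φ ∘ g) := by
  funext g
  simp only [coboundary, comp_contractNth]
  rfl

theorem map_coboundary (i : P →+ R) {n : ℕ} (f : (Fin n → G) → P) :
    coboundary (fun g => i (f g)) = fun g => i (coboundary f g) := by
  funext g
  simp [coboundary]

theorem coboundary_add {n : ℕ} (f f' : (Fin n → G) → P) :
    coboundary (f + f') = coboundary f + coboundary f' := by
  funext g
  simp only [coboundary, Pi.add_apply, smul_add, Finset.sum_add_distrib]
  abel

theorem coboundary_neg {n : ℕ} (f : (Fin n → G) → P) : coboundary (-f) = -coboundary f := by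
  funext g
  simp only [coboundary, Pi.neg_apply, smul_neg, Finset.sum_neg_distrib]
  abel

theorem coboundary_sub {n : ℕ} (f f' : (Fin n → G) → P) :
    coboundary (f - f') = coboundary f - coboundary f' := by
  rw [sub_eq_add_neg, coboundary_add, coboundary_neg, sub_eq_add_neg]

theorem coboundary_one_apply (f : (Fin 1 → G) → P) (x y : G) :
    coboundary f ![x, y] = f ![y] - f ![x * y] + f ![x] := by
  have h₀ : (fun i : Fin 1 => ![x, y] i.succ) = ![y] := by
    funext i; fin_cases i; rfl
  have h₁ : Fin.contractNth 0 (· * ·) ![x, y] = ![x * y] := by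
    funext i; fin_cases i; rfl
  have h₂ : Fin.contractNth 1 (· * ·) ![x, y] = ![x] := by
    funext i; fin_cases i; rfl
  refine (congrArg (f _ + ·) (Fin.sum_univ_two _)).trans ?_
  rw [h₀, h₁, h₂]
  simp
  abel

theorem coboundary_two_apply (f : (Fin 2 → G) → P) (x y z : G) :
    coboundary f ![x, y, z] = f ![y, z] - f ![x * y, z] + f ![x, y * z] - f ![x, y] := by
  have h₀ : (fun i : Fin 2 => ![x, y, z] i.succ) = ![y, z] := by
    funext i; fin_cases i <;> rfl
  have h₁ : Fin.contractNth 0 (· * ·) ![x, y, z] = ![x * y, z] := by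
    funext i; fin_cases i <;> rfl
  have h₂ : Fin.contractNth 1 (· * ·) ![x, y, z] = ![x, y * z] := by
    funext i; fin_cases i <;> rfl
  have h₃ : Fin.contractNth 2 (· * ·) ![x, y, z] = ![x, y] := by
    funext i; fin_cases i <;> rfl
  refine (congrArg (f _ + ·) (Fin.sum_univ_three _)).trans ?_
  rw [h₀, h₁, h₂, h₃]
  simp [pow_succ]
  abel

end Coboundary

section Compare

variable {G : Type u} [Group G]

theorem d_hom_eq_coboundary {k V : Type u} [CommRing k] [AddCommGroup V] [Module k V] {n : ℕ}
    (f : (Fin n → G) → V) :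
    (inhomogeneousCochains.d (Rep.trivial k G V) n).hom f = coboundary f := by
  funext g
  rw [inhomogeneousCochains.d_hom_apply]
  simp only [coboundary]
  congr 1
  refine Finset.sum_congr rfl fun j _ => ?_
  rw [← Int.cast_smul_eq_zsmul k]
  push_cast
  rfl

/-- Abelian groups are regarded as `ULift ℤ`-modules, because `Rep` wants the ring in the universe
of the group. -/
theorem coboundary_coboundary {P : Type u} [AddCommGroup P] {n : ℕ} (f : (Fin n → G) → P) :
    coboundary (coboundary f) = 0 := by
  have h := congr($(groupCohomology.inhomogeneousCochains.d_comp_d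
    (A := Rep.trivial (ULift.{u} ℤ) G P) n).hom f)
  rw [← d_hom_eq_coboundary (k := ULift.{u} ℤ), ← d_hom_eq_coboundary (k := ULift.{u} ℤ)]
  exact h

end Compare

/-! ### Quotients of `p`-power order and cochains inflated from them -/

section Level

variable {p : ℕ} {G : Type u} [Group G]

theorem FinQuot.mk_surjective (N : IndexNormal p G) : Function.Surjective (FinQuot.mk N) :=
  QuotientGroup.mk'_surjective N.carrier

theorem FinQuot.mk_eq_one {N : IndexNormal p G} {g : G} : FinQuot.mk N g = 1 ↔ g ∈ N.carrier :=
  QuotientGroup.eq_one_iff g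

theorem FinQuot.mk_eq_mk {N : IndexNormal p G} {g h : G} :
    FinQuot.mk N g = FinQuot.mk N h ↔ g⁻¹ * h ∈ N.carrier :=
  QuotientGroup.eq

theorem FinQuot.continuous_mk (N : IndexNormal p G) :
    @Continuous _ _ (topology p G) inferInstance (FinQuot.mk N) :=
  continuous_iff_le_induced.2 (iInf_le _ N)

theorem FinQuot.finite [hp : Fact p.Prime] (N : IndexNormal p G) : Finite (FinQuot p G N) := by
  obtain ⟨k, hk⟩ := N.index_eq
  have : N.carrier.FiniteIndex := ⟨by rw [hk]; exact pow_ne_zero _ hp.out.ne_zero⟩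
  exact Subgroup.finite_quotient_of_finiteIndex

/-- The whole group, as a normal subgroup of index `p ^ 0`. -/
instance : Inhabited (IndexNormal p G) :=
  ⟨⟨⊤, inferInstance, 0, by simp⟩⟩

/-- Normal subgroups of `p`-power index are closed under intersection. -/
def IndexNormal.inf [hp : Fact p.Prime] (N M : IndexNormal p G) : IndexNormal p G where
  carrier := N.carrier ⊓ M.carrier
  normal := inferInstance
  index_eq := by
    obtain ⟨k, hk⟩ := N.index_eq
    obtain ⟨l, hl⟩ := M.index_eq
    have h : (N.carrier ⊓ M.carrier).index ∣ p ^ (k + l) := by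
      rw [pow_add, ← hk, ← hl, ← Subgroup.relIndex_mul_index (inf_le_right : _ ≤ M.carrier),
        Subgroup.inf_relIndex_right]
      exact Nat.mul_dvd_mul_right (Subgroup.relIndex_dvd_index_of_normal _ _) _
    obtain ⟨m, -, hm⟩ := (Nat.dvd_prime_pow hp.out).1 h
    exact ⟨m, hm⟩

theorem exists_le_finset [Fact p.Prime] {ι : Type*} (s : Finset ι) (N : ι → IndexNormal p G) :
    ∃ M : IndexNormal p G, ∀ i ∈ s, M.carrier ≤ (N i).carrier := by
  classical
  induction s using Finset.induction_on with
  | empty => exact ⟨default, by simp⟩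
  | insert a s _ ih =>
    obtain ⟨M, hM⟩ := ih
    refine ⟨(N a).inf M, fun i hi => ?_⟩
    rcases Finset.mem_insert.1 hi with rfl | hi
    · exact inf_le_left
    · exact inf_le_right.trans (hM i hi)

/-- A cochain on `G` is of finite level if it is inflated from a quotient of `G` of `p`-power
order. -/
def FiniteLevel (p : ℕ) {n : ℕ} {P : Type*} (f : (Fin n → G) → P) : Prop :=
  ∃ (N : IndexNormal p G) (e : (Fin n → FinQuot p G N) → P), f = fun g => e (FinQuot.mk N ∘ g)

variable {n : ℕ} {P R : Type*}

theorem FiniteLevel.comp {f : (Fin n → G) → P} (hf : FiniteLevel p f) (φ : P → R) :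
    FiniteLevel p (fun g => φ (f g)) := by
  obtain ⟨N, e, rfl⟩ := hf
  exact ⟨N, fun x => φ (e x), rfl⟩

theorem FiniteLevel.coboundary [AddCommGroup P] {f : (Fin n → G) → P} (hf : FiniteLevel p f) :
    FiniteLevel p (coboundary f) := by
  obtain ⟨N, e, rfl⟩ := hf
  exact ⟨N, ProP.coboundary e, coboundary_comp_hom _ _⟩

theorem FiniteLevel.add [Fact p.Prime] [AddCommGroup P] {f f' : (Fin n → G) → P}
    (hf : FiniteLevel p f) (hf' : FiniteLevel p f') : FiniteLevel p (f + f') := by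
  obtain ⟨N, e, rfl⟩ := hf
  obtain ⟨N', e', rfl⟩ := hf'
  refine ⟨N.inf N', fun x => e (FinQuot.proj _ N inf_le_left ∘ x) +
    e' (FinQuot.proj _ N' inf_le_right ∘ x), rfl⟩

theorem FiniteLevel.neg [AddCommGroup P] {f : (Fin n → G) → P}
    (hf : FiniteLevel p f) : FiniteLevel p (-f) :=
  hf.comp (- ·)

end Level

/-! ### Topology of the pro-`p` completion -/

section Completion

variable {p : ℕ} {G : Type u} [Group G]

/-- The projection of the pro-`p` completion onto one of the finite quotients of `G`. -/
def Completion.proj (N : IndexNormal p G) : Completion p G →* FinQuot p G N :=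
  (Pi.evalMonoidHom _ N).comp (coherent p G).subtype

theorem Completion.continuous_proj (N : IndexNormal p G) : Continuous (Completion.proj N) :=
  (continuous_apply N).comp continuous_subtype_val

theorem Completion.proj_toCompletion (N : IndexNormal p G) (g : G) :
    Completion.proj N (toCompletion p G g) = FinQuot.mk N g := rfl

theorem Completion.ext_proj {x y : Completion p G} (h : ∀ N, proj N x = proj N y) : x = y :=
  Subtype.ext (funext h)

theorem Completion.proj_eq_of_le {N M : IndexNormal p G} (h : N.carrier ≤ M.carrier)
    {x y : Completion p G} (hxy : proj N x = proj N y) : proj M x = proj M y := by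
  have hx := x.2 N M h
  have hy := y.2 N M h
  change x.1 N = y.1 N at hxy
  change x.1 M = y.1 M
  rw [← hx, ← hy, hxy]

/-- The fibres of the projections to the finite quotients are a basis of neighbourhoods. -/
theorem Completion.exists_fiber_subset [Fact p.Prime] {U : Set (Completion p G)} (hU : IsOpen U)
    {x : Completion p G} (hx : x ∈ U) :
    ∃ N : IndexNormal p G, ∀ y, proj N y = proj N x → y ∈ U := by
  obtain ⟨V, hV, rfl⟩ := isOpen_induced_iff.1 hU
  obtain ⟨s, u, hu, hsub⟩ := isOpen_pi_iff.1 hV x.1 hx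
  obtain ⟨M, hM⟩ := exists_le_finset s id
  refine ⟨M, fun y hy => hsub fun N hN => ?_⟩
  have h : y.1 N = x.1 N := proj_eq_of_le (hM N hN) hy
  rw [h]
  exact (hu N hN).2

instance [Fact p.Prime] : CompactSpace (Completion p G) := by
  have (N : IndexNormal p G) : Finite (FinQuot p G N) := FinQuot.finite N
  have hc : IsClosed ((coherent p G : Subgroup _) : Set (∀ N : IndexNormal p G, FinQuot p G N)) := by
    have : ((coherent p G : Subgroup _) : Set (∀ N : IndexNormal p G, FinQuot p G N)) =
      ⋂ N, ⋂ M, ⋂ h, {x | FinQuot.proj N M h (x N) = x M} := by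
      ext x
      simp only [Set.mem_iInter]
      rfl
    rw [this]
    refine isClosed_iInter fun N => isClosed_iInter fun M => isClosed_iInter fun h => ?_
    exact isClosed_eq (continuous_of_discreteTopology.comp (continuous_apply N))
      (continuous_apply M)
  exact isCompact_iff_compactSpace.1 hc.isCompact

/-- By compactness, a locally constant function of several variables in the pro-`p` completion
only depends on the images of these variables in one finite quotient. -/
theorem Completion.exists_level_of_isLocallyConstant [Fact p.Prime] {n : ℕ} {P : Type*}
    {f : (Fin n → Completion p G) → P} (hf : IsLocallyConstant f) :
    ∃ N : IndexNormal p G, ∀ x y, proj N ∘ x = proj N ∘ y → f x = f y := by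
  have key (x : Fin n → Completion p G) :
      ∃ N : IndexNormal p G, ∀ y, proj N ∘ y = proj N ∘ x → f y = f x := by
    obtain ⟨u, hu, hsub⟩ := isOpen_pi_iff'.1 (hf.isOpen_fiber (f x)) x rfl
    choose N hN using fun i => exists_fiber_subset (hu i).1 (hu i).2
    obtain ⟨M, hM⟩ := exists_le_finset Finset.univ N
    refine ⟨M, fun y hy => hsub fun i _ => hN i _ ?_⟩
    exact proj_eq_of_le (hM i (Finset.mem_univ i)) (congrFun hy i)
  choose N hN using key
  obtain ⟨t, ht⟩ := isCompact_univ.elim_finite_subcover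
    (fun x => {y | proj (N x) ∘ y = proj (N x) ∘ x})
    (fun x => by
      have hc : Continuous fun y : Fin n → Completion p G => proj (N x) ∘ y :=
        continuous_pi fun i => (continuous_proj _).comp (continuous_apply i)
      exact (isOpen_discrete {proj (N x) ∘ x}).preimage hc)
    (fun x _ => Set.mem_iUnion.2 ⟨x, rfl⟩)
  obtain ⟨M, hM⟩ := exists_le_finset t N
  refine ⟨M, fun x y hxy => ?_⟩
  obtain ⟨z, hz, hx⟩ := Set.mem_iUnion₂.1 (ht (Set.mem_univ x))
  have hy : proj (N z) ∘ y = proj (N z) ∘ z := by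
    refine Eq.trans (funext fun i => ?_) hx
    exact (proj_eq_of_le (hM z hz) (congrFun hxy i)).symm
  rw [hN z x hx, hN z y hy]

theorem FiniteLevel.of_isLocallyConstant [Fact p.Prime] {n : ℕ} {P : Type*}
    {f : (Fin n → Completion p G) → P} (hf : IsLocallyConstant f) :
    FiniteLevel p (fun g : Fin n → G => f (toCompletion p G ∘ g)) := by
  obtain ⟨N, hN⟩ := Completion.exists_level_of_isLocallyConstant hf
  choose s hs using FinQuot.mk_surjective N
  refine ⟨N, fun x => f (toCompletion p G ∘ s ∘ x), funext fun g => hN _ _ (funext fun i => ?_)⟩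
  exact (hs _).symm

end Completion

/-! ### The class `𝒞` in terms of cochains -/

section ClassC

variable {p : ℕ} [Fact p.Prime] {Q : Type u} [Group Q]

/-- Surjectivity of the comparison map in degree `n + 1`, on cochains. -/
theorem ClassC.exists_finiteLevel_sub (hQ : ClassC Q) {n : ℕ}
    (f : (Fin (n + 1) → Q) → ULift.{u} (ZMod p)) (hf : coboundary f = 0) :
    ∃ h : (Fin n → Q) → ULift.{u} (ZMod p), FiniteLevel p (f - coboundary h) := by
  have := hQ p (n + 1)
  have : Epi (HomologicalComplex.homologyMap
    (pullback (ULift.{u} (ZMod p)) (toCompletion p Q)) (n + 1)) :=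
    inferInstanceAs (Epi (pullbackCohomology _ _ (n + 1)))
  obtain ⟨x, w, -, h⟩ := exists_cocycle_of_epi (pullback (ULift.{u} (ZMod p)) (toCompletion p Q)) n
    f (by
      rw [groupCohomology.inhomogeneousCochains.d_def]
      exact (d_hom_eq_coboundary f).trans hf)
  rw [groupCohomology.inhomogeneousCochains.d_def] at h
  refine ⟨w, ?_⟩
  have hw : f = (fun g => x.1 (toCompletion p Q ∘ g)) + coboundary w := by
    rw [← d_hom_eq_coboundary]
    exact h
  rw [hw, add_sub_cancel_right]
  exact FiniteLevel.of_isLocallyConstant x.2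

/-- Injectivity of the comparison map in degree `n + 1`, on cochains. -/
theorem ClassC.exists_finiteLevel_primitive (hQ : ClassC Q) {n : ℕ}
    (f : (Fin n → Q) → ULift.{u} (ZMod p)) (hf : FiniteLevel p (coboundary f)) :
    ∃ f' : (Fin n → Q) → ULift.{u} (ZMod p), FiniteLevel p f' ∧ coboundary f' = coboundary f := by
  obtain ⟨N, e, he⟩ := hf
  have := hQ p (n + 1)
  have : Mono (HomologicalComplex.homologyMap
    (pullback (ULift.{u} (ZMod p)) (toCompletion p Q)) (n + 1)) :=
    inferInstanceAs (Mono (pullbackCohomology _ _ (n + 1)))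
  -- `e` is a cocycle already on the finite quotient, since `Q` maps onto it.
  have hde : coboundary e = 0 := by
    funext x
    choose s hs using FinQuot.mk_surjective N
    have h := congrFun (coboundary_comp_hom (FinQuot.mk N) e) (s ∘ x)
    rw [← he, coboundary_coboundary, ← Function.comp_assoc,
      show FinQuot.mk N ∘ s = id from funext hs, Function.id_comp] at h
    exact h.symm
  let E : contCochainsX (ULift.{u} (ZMod p)) (Completion p Q) (n + 1) :=
    ⟨fun x => e (Completion.proj N ∘ x), by
      have hc : Continuous fun y : Fin (n + 1) → Completion p Q => Completion.proj N ∘ y :=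
        continuous_pi fun i => (Completion.continuous_proj _).comp (continuous_apply i)
      exact (IsLocallyConstant.of_discrete e).comp_continuous hc⟩
  obtain ⟨v, hv⟩ := exists_primitive_of_mono
    (pullback (ULift.{u} (ZMod p)) (toCompletion p Q)) n E (by
      rw [contCochains.d_def]
      refine Subtype.ext ((d_hom_eq_coboundary E.1).trans ?_)
      refine (coboundary_comp_hom (Completion.proj N) e).trans ?_
      rw [hde]
      rfl) f (by
      rw [groupCohomology.inhomogeneousCochains.d_def]
      refine Eq.trans ?_ (d_hom_eq_coboundary f).symm
      exact he.symm)
  rw [contCochains.d_def] at hv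
  refine ⟨_, FiniteLevel.of_isLocallyConstant v.2, ?_⟩
  have hv' : coboundary v.1 = E.1 := (d_hom_eq_coboundary v.1).symm.trans congr(Subtype.val $hv)
  rw [coboundary_comp_hom, hv', he]
  rfl

end ClassC

/-! ### Dévissage to finite abelian `p`-groups -/

section Coefficients

variable {p : ℕ} [hp : Fact p.Prime] {Q : Type u} [Group Q]

/-- An element of order `p` gives an embedding of `ℤ/p` onto the subgroup it generates. -/
theorem exists_zmod_hom {P : Type u} [AddCommGroup P] {a : P} (ha : addOrderOf a = p) :
    ∃ i : ULift.{u} (ZMod p) →+ P, Function.Injective i ∧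
      ∀ b, b ∈ AddSubgroup.zmultiples a ↔ ∃ c, i c = b := by
  let j : ZMod p →+ P := ZMod.lift p ⟨zmultiplesHom P a, by
    simpa using ha ▸ addOrderOf_nsmul_eq_zero a⟩
  have hj (m : ℤ) : j m = m • a := by simp [j]
  refine ⟨j.comp AddEquiv.ulift.toAddMonoidHom, ?_, fun b => ?_⟩
  · refine Function.Injective.comp (g := j) ?_ (AddEquiv.ulift (α := ZMod p)).injective
    refine (injective_iff_map_eq_zero j).2 fun x hx => ?_
    obtain ⟨m, rfl⟩ := ZMod.intCast_surjective x
    rw [hj, ← addOrderOf_dvd_iff_zsmul_eq_zero, ha] at hx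
    exact (ZMod.intCast_zmod_eq_zero_iff_dvd m p).2 hx
  · rw [AddSubgroup.mem_zmultiples_iff]
    constructor
    · rintro ⟨m, rfl⟩
      exact ⟨⟨m⟩, hj m⟩
    · rintro ⟨⟨x⟩, rfl⟩
      obtain ⟨m, rfl⟩ := ZMod.intCast_surjective x
      exact ⟨m, (hj m).symm⟩

/-- Surjectivity of the comparison map passes from `ℤ/p` to all finite abelian `p`-groups with
trivial action: the dévissage along `ℤ/p ↪ P ↠ P'` uses the injectivity one degree higher. -/
theorem ClassC.exists_finiteLevel_sub_of_card (hQ : ClassC Q) {n : ℕ} (k : ℕ) :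
    ∀ (P : Type u) [AddCommGroup P], Nat.card P = p ^ k →
      ∀ f : (Fin (n + 1) → Q) → P, coboundary f = 0 →
        ∃ h : (Fin n → Q) → P, FiniteLevel p (f - coboundary h) := by
  induction k with
  | zero =>
    intro P _ hP f _
    have : Subsingleton P := (Nat.card_eq_one_iff_unique.1 (by simpa using hP)).1
    exact ⟨0, default, 0, Subsingleton.elim _ _⟩
  | succ k ih =>
    intro P _ hP f hf
    have : Finite P := Nat.finite_of_card_ne_zero (by rw [hP]; exact pow_ne_zero _ hp.out.ne_zero)
    obtain ⟨a, ha⟩ := exists_prime_addOrderOf_dvd_card' (G := P) p (by rw [hP, pow_succ]; simp)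
    obtain ⟨i, hi, hrange⟩ := exists_zmod_hom ha
    let π := QuotientAddGroup.mk' (AddSubgroup.zmultiples a)
    have hcard : Nat.card (P ⧸ AddSubgroup.zmultiples a) = p ^ k := by
      have h := AddSubgroup.card_eq_card_quotient_mul_card_addSubgroup (AddSubgroup.zmultiples a)
      rw [hP, Nat.card_zmultiples, ha, pow_succ] at h
      exact (Nat.eq_of_mul_eq_mul_right hp.out.pos h).symm
    obtain ⟨h₁, hh₁⟩ := ih _ hcard (fun g => π (f g)) (by
      rw [map_coboundary, hf]
      exact funext fun _ => map_zero π)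
    choose σ hσ using QuotientAddGroup.mk'_surjective (AddSubgroup.zmultiples a)
    -- Lift the solution modulo `ℤ/p` along a set-theoretic section; the error has values in `ℤ/p`.
    set h₂ : (Fin n → Q) → P := fun g => σ (h₁ g)
    let e : (Fin (n + 1) → Q) → P := fun g => σ (π (f g) - coboundary h₁ g)
    have he : FiniteLevel p e := hh₁.comp σ
    have herr (g) : ∃ c : ULift.{u} (ZMod p), i c = (f - coboundary h₂ - e) g := by
      rw [← hrange, ← QuotientAddGroup.eq_zero_iff]
      change π _ = 0
      have h₃ : π (coboundary h₂ g) = coboundary h₁ g := by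
        refine (congrFun (map_coboundary π h₂) g).symm.trans ?_
        congr 1
        exact funext fun g => hσ (h₁ g)
      have h₄ : π (e g) = π (f g) - coboundary h₁ g := hσ _
      simp only [Pi.sub_apply, map_sub, h₃, h₄, sub_self]
    choose f₀ hf₀ using herr
    replace hf₀ : (fun g => i (f₀ g)) = f - coboundary h₂ - e := funext hf₀
    -- The coboundary of `f₀` is that of `-e`, so it is inflated from a finite quotient.
    have hlevel : FiniteLevel p (coboundary f₀) := by
      have h₅ : (fun g => i (coboundary f₀ g)) = -coboundary e := by
        rw [← map_coboundary, hf₀, coboundary_sub, coboundary_sub, hf,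
          coboundary_coboundary, sub_zero, zero_sub]
      have h₆ := (h₅ ▸ he.coboundary.neg).comp (Function.invFun i)
      simpa only [Function.leftInverse_invFun hi _] using h₆
    obtain ⟨f₁, hf₁, hd⟩ := hQ.exists_finiteLevel_primitive f₀ hlevel
    obtain ⟨w, hw⟩ := hQ.exists_finiteLevel_sub (p := p) (f₀ - f₁) (by
      rw [coboundary_sub, hd, sub_self])
    refine ⟨h₂ + fun g => i (w g), ?_⟩
    have hsum := (he.add (hf₁.comp i)).add (hw.comp i)
    convert hsum using 1
    have h₇ : f = (fun g => i (f₀ g)) + coboundary h₂ + e := by rw [hf₀]; abel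
    rw [coboundary_add, map_coboundary, h₇]
    funext g
    simp only [Pi.add_apply, Pi.sub_apply, map_sub]
    abel

end Coefficients

/-! ### Central extensions -/

section Extension

variable {p : ℕ} {A G Q : Type u} [Group A] [Group G] [Group Q]

/-- A set-theoretic `A`-equivariant map `ρ` from `G` to a quotient `P` of `A`, whose deviation
from being a homomorphism is of finite level, cuts out a subgroup of `p`-power index of `G`
meeting `A` in the kernel of `A → P`. -/
theorem exists_indexNormal_of_map (S : GroupExtension A G Q) {P : Type*} [AddCommGroup P]
    (hP : ∃ k, Nat.card P = p ^ k) {ψ : A → P} (hψ : Function.Surjective ψ)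
    {N : IndexNormal p Q} {ρ : G → P} {e : FinQuot p Q N → FinQuot p Q N → P}
    (hρψ : ∀ a g, ρ (S.inl a * g) = ψ a + ρ g)
    (hρ : ∀ g h, ρ (g * h) =
      ρ g + ρ h + e (FinQuot.mk N (S.rightHom g)) (FinQuot.mk N (S.rightHom h))) :
    ∃ M : IndexNormal p G, ∀ a, S.inl a ∈ M.carrier → ψ a = 0 := by
  -- Evaluating the defect of `ρ` at `(g, 1)` and `(1, g)` shows that `e` is constant on the axes.
  have hright (x) : e x 1 = -ρ 1 := by
    obtain ⟨q, rfl⟩ := FinQuot.mk_surjective N x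
    obtain ⟨g, rfl⟩ := S.rightHom_surjective q
    have h := hρ g 1
    rw [mul_one, map_one, map_one, add_assoc, left_eq_add] at h
    exact (neg_eq_of_add_eq_zero_right h).symm
  have hleft (x) : e 1 x = -ρ 1 := by
    obtain ⟨q, rfl⟩ := FinQuot.mk_surjective N x
    obtain ⟨g, rfl⟩ := S.rightHom_surjective q
    have h := hρ 1 g
    rw [one_mul, map_one, map_one, add_right_comm, right_eq_add] at h
    exact (neg_eq_of_add_eq_zero_right h).symm
  let ε : G →* FinQuot p Q N := (FinQuot.mk N).comp S.rightHom
  have hmul (g m : G) (hm : ε m = 1) : ρ (g * m) = ρ g + ρ m - ρ 1 := by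
    rw [hρ, show FinQuot.mk N (S.rightHom m) = 1 from hm, hright, sub_eq_add_neg]
  have hmul' (m g : G) (hm : ε m = 1) : ρ (m * g) = ρ m + ρ g - ρ 1 := by
    rw [hρ, show FinQuot.mk N (S.rightHom m) = 1 from hm, hleft, sub_eq_add_neg]
  let K : Subgroup G :=
    { carrier := {g | ε g = 1 ∧ ρ g = ρ 1}
      one_mem' := ⟨map_one _, rfl⟩
      mul_mem' := by
        rintro g m ⟨hg, hg'⟩ ⟨hm, hm'⟩
        refine ⟨by rw [map_mul, hg, hm, one_mul], ?_⟩
        rw [hmul g m hm, hg', hm', add_sub_cancel_right]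
      inv_mem' := by
        rintro g ⟨hg, hg'⟩
        refine ⟨by rw [map_inv, hg, inv_one], ?_⟩
        have h := hmul' g g⁻¹ hg
        rwa [mul_inv_cancel, hg', add_sub_cancel_left, eq_comm] at h }
  have hK (g) : g ∈ K ↔ ε g = 1 ∧ ρ g = ρ 1 := Iff.rfl
  have hnormal : K.Normal := by
    refine ⟨fun m hm g => ?_⟩
    obtain ⟨hm, hm'⟩ := (hK m).1 hm
    have hε : ε (g * m * g⁻¹) = 1 := by simp [hm]
    refine (hK _).2 ⟨hε, ?_⟩
    have h := hmul' (g * m * g⁻¹) g hε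
    rwa [inv_mul_cancel_right, hmul g m hm, hm', add_sub_cancel_right, add_sub_right_comm,
      right_eq_add, sub_eq_zero] at h
  -- `g ↦ (ε g, ρ g)` identifies `G ⧸ K` with `Q ⧸ N × P`, which gives the index of `K`.
  have hfiber (g h : G) : g⁻¹ * h ∈ K ↔ (ε g, ρ g) = (ε h, ρ h) := by
    rw [hK, map_mul, map_inv, inv_mul_eq_one, Prod.mk.injEq]
    refine and_congr_right fun hε => ?_
    have h₁ := hmul g (g⁻¹ * h) (by rw [map_mul, map_inv, hε, inv_mul_cancel])
    rw [mul_inv_cancel_left] at h₁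
    rw [h₁, add_sub_assoc, left_eq_add, sub_eq_zero]
  let F : G ⧸ K → FinQuot p Q N × P :=
    Quotient.lift (fun g => (ε g, ρ g)) fun g h hgh =>
      (hfiber g h).1 (QuotientGroup.leftRel_apply.1 hgh)
  have hF : Function.Bijective F := by
    constructor
    · intro x y hxy
      induction x using QuotientGroup.induction_on
      induction y using QuotientGroup.induction_on
      exact QuotientGroup.eq.2 ((hfiber _ _).2 hxy)
    · rintro ⟨x, b⟩
      obtain ⟨q, rfl⟩ := FinQuot.mk_surjective N x
      obtain ⟨g, rfl⟩ := S.rightHom_surjective q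
      obtain ⟨a, ha⟩ := hψ (b - ρ g)
      refine ⟨QuotientGroup.mk (S.inl a * g), Prod.ext ?_ ?_⟩
      · change FinQuot.mk N (S.rightHom _) = _
        simp
      · change ρ _ = b
        rw [hρψ, ha, sub_add_cancel]
  refine ⟨⟨K, hnormal, ?_⟩, fun a ha => ?_⟩
  · obtain ⟨k, hk⟩ := hP
    obtain ⟨l, hl⟩ := N.index_eq
    refine ⟨l + k, ?_⟩
    rw [pow_add, ← hl, ← hk]
    exact (Nat.card_congr (Equiv.ofBijective F hF)).trans (Nat.card_prod _ _)
  · have h := ((hK _).1 ha).2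
    rw [← mul_one (S.inl a), hρψ, add_eq_right] at h
    exact h

/-- The central step: subgroups of `p`-power index of the kernel `A` of a central extension are
refined by the traces of such subgroups of `G`. The class of the extension pushed out to `A ⧸ N`
is inflated from a finite quotient of `Q`. -/
theorem exists_indexNormal_comap_inl_le [Fact p.Prime] (S : GroupExtension A G Q)
    (hcentral : S.inl.range ≤ Subgroup.center G) (hQ : ClassC Q) (N : IndexNormal p A) :
    ∃ M : IndexNormal p G, (M.comap S.inl).carrier ≤ N.carrier := by
  have hcomm (a : A) (g : G) : g * S.inl a = S.inl a * g :=
    Subgroup.mem_center_iff.1 (hcentral ⟨a, rfl⟩) g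
  let : CommGroup (A ⧸ N.carrier) :=
    { (inferInstance : Group (A ⧸ N.carrier)) with
      mul_comm := fun x y => by
        induction x using QuotientGroup.induction_on with | H a
        induction y using QuotientGroup.induction_on with | H b
        rw [← QuotientGroup.mk_mul, ← QuotientGroup.mk_mul,
          S.inl_injective (by rw [map_mul, map_mul, hcomm] : S.inl (a * b) = S.inl (b * a))] }
  let ψ (a : A) : Additive (A ⧸ N.carrier) := Additive.ofMul (QuotientGroup.mk a)
  have hψmul (a b) : ψ (a * b) = ψ a + ψ b := rfl
  choose s hs using S.rightHom_surjective
  have hr (g : G) : ∃ a, S.inl a * s (S.rightHom g) = g := by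
    have hg : g * (s (S.rightHom g))⁻¹ ∈ S.inl.range := by
      rw [S.range_inl_eq_ker_rightHom, MonoidHom.mem_ker, map_mul, map_inv, hs, mul_inv_cancel]
    obtain ⟨a, ha⟩ := hg
    exact ⟨a, by rw [ha, inv_mul_cancel_right]⟩
  -- `r g` is the `A`-component of `g` with respect to the section `s`.
  choose r hr using hr
  have hr_unique (a : A) (x : Q) (g : G) (h : S.inl a * s x = g) : r g = a := by
    have hx : S.rightHom g = x := by rw [← h, map_mul, S.rightHom_inl, one_mul, hs]
    refine S.inl_injective (mul_right_cancel (b := s x) ?_)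
    rw [h, ← hx, hr]
  let ρ (g : G) := ψ (r g)
  have hρψ (a : A) (g : G) : ρ (S.inl a * g) = ψ a + ρ g := by
    rw [← hψmul]
    refine congrArg ψ (hr_unique _ (S.rightHom g) _ ?_)
    rw [map_mul, mul_assoc, hr]
  have hρ (g h : G) : ρ (g * h) = ρ g + ρ h + ρ (s (S.rightHom g) * s (S.rightHom h)) := by
    have hgh : g * h =
        S.inl (r g) * (S.inl (r h) * (s (S.rightHom g) * s (S.rightHom h))) := by
      rw [← mul_assoc (S.inl (r h)), ← hcomm (r h), mul_assoc (s _), hr, ← mul_assoc, hr]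
    rw [hgh, hρψ, hρψ, add_assoc]
  have hρs (x : Q) : ρ (s x) = 0 :=
    congrArg ψ (hr_unique 1 x (s x) (by rw [map_one, one_mul]))
  let c (v : Fin 2 → Q) := ρ (s (v 0) * s (v 1))
  have hc : coboundary c = 0 := by
    funext v
    have h₁ := hρ (s (v 0) * s (v 1)) (s (v 2))
    have h₂ := hρ (s (v 0)) (s (v 1) * s (v 2))
    rw [mul_assoc, h₂] at h₁
    simp only [map_mul, hs, hρs] at h₁
    have hv : v = ![v 0, v 1, v 2] := by
      funext i; fin_cases i <;> rfl
    rw [hv, coboundary_two_apply]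
    change ρ (s (v 1) * s (v 2)) - ρ (s (v 0 * v 1) * s (v 2)) + ρ (s (v 0) * s (v 1 * v 2)) -
      ρ (s (v 0) * s (v 1)) = 0
    rw [zero_add, add_zero] at h₁
    rw [sub_add_eq_add_sub, h₁]
    abel
  obtain ⟨k, hk⟩ := N.index_eq
  obtain ⟨h, N', e, he⟩ := hQ.exists_finiteLevel_sub_of_card (p := p) k
    (Additive (A ⧸ N.carrier)) hk c hc
  -- Changing `ρ` by `h` changes its defect `c` by the coboundary of `h`.
  obtain ⟨M, hM⟩ := exists_indexNormal_of_map S (P := Additive (A ⧸ N.carrier)) ⟨k, hk⟩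
    (ψ := ψ) (N := N') (ρ := fun g => ρ g + h ![S.rightHom g])
    (e := fun x y => e ![x, y]) QuotientGroup.mk_surjective
    (fun a g => by rw [hρψ, map_mul, S.rightHom_inl, one_mul, add_assoc])
    (fun g g' => by
      have h₁ := congrFun he ![S.rightHom g, S.rightHom g']
      rw [Pi.sub_apply, coboundary_one_apply, sub_eq_iff_eq_add] at h₁
      have h₂ : FinQuot.mk N' ∘ ![S.rightHom g, S.rightHom g'] =
          ![FinQuot.mk N' (S.rightHom g), FinQuot.mk N' (S.rightHom g')] := by
        funext i; fin_cases i <;> rfl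
      rw [hρ, map_mul, ← h₂, show ρ (s (S.rightHom g) * s (S.rightHom g')) = _ from h₁]
      abel)
  exact ⟨M, fun a ha => (QuotientGroup.eq_one_iff a).1 (hM a ha)⟩

end Extension

/-! ### Exactness and embedding -/

section Exactness

variable {p : ℕ} [hp : Fact p.Prime] {A G Q : Type u} [Group A] [Group G] [Group Q]

theorem Completion.proj_map (f : G →* Q) (M : IndexNormal p Q) (x : Completion p G) :
    proj M (map p f x) = FinQuot.map f (M.comap f) M le_rfl (proj (M.comap f) x) := rfl

theorem Completion.map_toCompletion (f : G →* Q) (g : G) :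
    map p f (toCompletion p G g) = toCompletion p Q (f g) := rfl

/-- Membership in a closed subset of the completion can be tested in the finite quotients. -/
theorem Completion.mem_of_isClosed {C : Set (Completion p G)} (hC : IsClosed C)
    {x : Completion p G} (h : ∀ N : IndexNormal p G, ∃ y ∈ C, proj N y = proj N x) : x ∈ C := by
  by_contra hx
  obtain ⟨N, hN⟩ := exists_fiber_subset hC.isOpen_compl (x := x) hx
  obtain ⟨y, hy, hyx⟩ := h N
  exact hN y hyx hy

theorem Completion.isClosed_range_map (f : G →* Q) : IsClosed (Set.range (map p f)) :=
  (isCompact_range (map p f).continuous_toFun).isClosed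

theorem Completion.map_surjective {f : G →* Q} (hf : Function.Surjective f) :
    Function.Surjective (map p f) := by
  refine fun y => mem_of_isClosed (isClosed_range_map f) fun N => ?_
  obtain ⟨q, hq⟩ := FinQuot.mk_surjective N (proj N y)
  obtain ⟨g, rfl⟩ := hf q
  exact ⟨_, ⟨toCompletion p G g, rfl⟩, hq⟩

theorem Completion.map_injective {f : A →* G}
    (hf : ∀ N : IndexNormal p A, ∃ M : IndexNormal p G, (M.comap f).carrier ≤ N.carrier) :
    Function.Injective (map p f) := by
  refine (injective_iff_map_eq_one (map p f)).2 fun x hx => ext_proj fun N => ?_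
  obtain ⟨M, hM⟩ := hf N
  refine proj_eq_of_le hM ?_
  have h : proj M (map p f x) = 1 := by rw [hx, map_one]
  rw [proj_map] at h
  obtain ⟨a, ha⟩ := FinQuot.mk_surjective (M.comap f) (proj (M.comap f) x)
  rw [← ha] at h ⊢
  exact FinQuot.mk_eq_one.2 (FinQuot.mk_eq_one (N := M).1 h)

/-- The image of a normal subgroup of `p`-power index under a surjective homomorphism. -/
def IndexNormal.map {f : G →* Q} (hf : Function.Surjective f) (N : IndexNormal p G) :
    IndexNormal p Q where
  carrier := N.carrier.map f
  normal := N.normal.map f hf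
  index_eq := by
    obtain ⟨k, hk⟩ := N.index_eq
    have h : (N.carrier.map f).index ∣ p ^ k := hk ▸ Subgroup.index_map_dvd _ hf
    obtain ⟨m, -, hm⟩ := (Nat.dvd_prime_pow hp.out).1 h
    exact ⟨m, hm⟩

/-- Pro-`p` completion is right exact. -/
theorem Completion.range_map_eq_ker (S : GroupExtension A G Q) :
    (map p S.inl).toMonoidHom.range = (map p S.rightHom).toMonoidHom.ker := by
  refine le_antisymm ?_ fun x hx => ?_
  · rintro _ ⟨x, rfl⟩
    refine ext_proj fun N => ?_
    change proj N (map p S.rightHom (map p S.inl x)) = 1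
    rw [proj_map, proj_map]
    obtain ⟨a, ha⟩ := FinQuot.mk_surjective _ (proj ((N.comap S.rightHom).comap S.inl) x)
    rw [← ha]
    change FinQuot.mk N (S.rightHom (S.inl a)) = 1
    rw [S.rightHom_inl, map_one]
  · refine mem_of_isClosed (isClosed_range_map S.inl) fun M => ?_
    let N := M.map S.rightHom_surjective
    have h : proj N (map p S.rightHom x) = 1 := by
      rw [show map p S.rightHom x = 1 from hx, map_one]
    obtain ⟨g, hg⟩ := FinQuot.mk_surjective M (proj M x)
    have hM : M.carrier ≤ (N.comap S.rightHom).carrier := Subgroup.le_comap_map _ _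
    have hg' : proj (N.comap S.rightHom) (toCompletion p G g) = proj (N.comap S.rightHom) x :=
      proj_eq_of_le hM hg
    rw [proj_map, ← hg'] at h
    obtain ⟨m, hm, hmg⟩ : S.rightHom g ∈ M.carrier.map S.rightHom := FinQuot.mk_eq_one.1 h
    obtain ⟨a, ha⟩ : g * m⁻¹ ∈ S.inl.range := by
      rw [S.range_inl_eq_ker_rightHom, MonoidHom.mem_ker, map_mul, map_inv, hmg, mul_inv_cancel]
    refine ⟨_, ⟨toCompletion p A a, rfl⟩, ?_⟩
    rw [map_toCompletion, proj_toCompletion, ha, map_mul, hg, map_inv, FinQuot.mk_eq_one.2 hm,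
      inv_one, mul_one]

theorem topologicallyEmbedded_of_exists_le {H : Subgroup G}
    (hH : ∀ N : IndexNormal p H, ∃ M : IndexNormal p G, (M.comap H.subtype).carrier ≤ N.carrier) :
    TopologicallyEmbedded p H := by
  refine le_antisymm (le_iInf fun N => ?_) ?_
  · obtain ⟨M, hM⟩ := hH N
    let _ : TopologicalSpace G := topology p G
    have hfac : Function.FactorsThrough (FinQuot.mk N) fun h : H => FinQuot.mk M (h : G) :=
      fun x y hxy => FinQuot.mk_eq_mk.2 (hM (FinQuot.mk_eq_mk (N := M).1 hxy))
    rw [← continuous_iff_le_induced, ← hfac.extend_comp fun _ => 1]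
    exact continuous_of_discreteTopology.comp ((FinQuot.continuous_mk M).comp continuous_subtype_val)
  · rw [topology, induced_iInf]
    refine le_iInf fun M => ?_
    rw [induced_compose, ← continuous_iff_le_induced]
    let _ : TopologicalSpace H := topology p H
    exact (continuous_of_discreteTopology (f := FinQuot.map H.subtype (M.comap H.subtype) M le_rfl)).comp
      (FinQuot.continuous_mk (M.comap H.subtype))

theorem topologicallyEmbedded_range {f : A →* G}
    (hf : ∀ N : IndexNormal p A, ∃ M : IndexNormal p G, (M.comap f).carrier ≤ N.carrier) :
    TopologicallyEmbedded p f.range := by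
  refine topologicallyEmbedded_of_exists_le fun N => ?_
  obtain ⟨M, hM⟩ := hf (N.comap f.rangeRestrict)
  refine ⟨M, ?_⟩
  rintro ⟨_, a, rfl⟩ ha
  exact hM ha

end Exactness

end ProP

theorem proposition1p1 {A G Q : Type u} [Group A] [Group G] [Group Q]
    (S : GroupExtension A G Q) (hcentral : S.inl.range ≤ Subgroup.center G)
    (hA : Group.FG A) (hQ : ProP.ClassC Q) (p : ℕ) [Fact p.Prime] :
    (Function.Injective (ProP.Completion.map p S.inl) ∧
      (ProP.Completion.map p S.inl).toMonoidHom.range =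
        (ProP.Completion.map p S.rightHom).toMonoidHom.ker ∧
      Function.Surjective (ProP.Completion.map p S.rightHom)) ∧
    ProP.TopologicallyEmbedded p S.inl.range := by
  have key := ProP.exists_indexNormal_comap_inl_le (p := p) S hcentral hQ
  exact ⟨⟨ProP.Completion.map_injective key, ProP.Completion.range_map_eq_ker S,
    ProP.Completion.map_surjective S.rightHom_surjective⟩, ProP.topologicallyEmbedded_range key⟩
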